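/- Work in $\mathbb{Z}[[x,q]]$ and let $\mathscr{S}\subset\mathbb{Z}[[x,q]]$ be the set of series $f$ with $f(0,q)=f(x,0)=1$. Consider the system of $x,q$-difference equations $$ \begin{bmatrix} F_0(x,q)\\ F_1(x,q)\\ F_2(x,q)\\ F_3(x,q)\\ F_4(x,q)\\ F_5(x,q)\\ F_7(x,q)\end{bmatrix} = \begin{bmatrix} 1&xq^2&x^2q^4&xq&x^2q^2&0&0\\ 0&xq^2&0&0&0&1&0\\ 0&0&0&0&0&0&1\\ 0&xq^2&0&xq&0&1&0\\ 0&0&0&0&xq^2&0&1\\ 1&xq^2&x^2q^4&xq&0&0&0\\ 1&xq^2&x^2q^4&0&0&0&0 \end{bmatrix} \begin{bmatrix} F_0(xq^2,q)\\ F_1(xq^2,q)\\ F_2(xq^2,q)\\ F_3(xq^2,q)\\ F_4(xq^2,q)\\ F_5(xq^2,q)\\ F_7(xq^2,q)\end{bmatrix}. $$ For integers $A,B,C,D$ put $$ S_{A,B,C,D}(x,q)=\sum_{i,j,k,\ell\ge 0} \frac{x^{2i+3j+2k+\ell}\,q^{4i^2+12ij+8ik+4i\ell+12j^2+16jk+8j\ell+6k^2+6k\ell+2\ell^2+Ai+Bj+Ck+D\ell}}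 {(q^2;q^2)_i\,(q^2;q^2)_j\,(q;q)_k\,(q;q)_\ell}, \qquad (a;p)_n=\prod_{0\le t<n}(1-ap^t), $$ a formal power series in $x$ whose coefficients are formal Laurent series in $q$. The system has exactly one solution $(F_0,F_1,F_2,F_3,F_4,F_5,F_7)$ with all entries in $\mathscr{S}$, and for this solution $$ F_1(x,q)=S_{2,2,1,0}(x,q),\qquad F_5(x,q)=S_{0,-2,-2,-1}(x,q),\qquad F_7(x,q)=S_{0,0,0,0}(x,q). $$ -/

import Mathlib

noncomputable section

namespace NandiSums

open PowerSeries Finset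

/-- The ring `ℤ[[x, q]]`, realised as `(ℤ[[q]])[[x]]`: the outer variable is `x`, and the
coefficient ring is `ℤ[[q]]`. -/
abbrev XQSeries : Type := PowerSeries (PowerSeries ℤ)

/-- The variable `x` of `ℤ[[x, q]]`. -/
def x : XQSeries := PowerSeries.X

/-- The variable `q` of `ℤ[[q]]`. -/
def q : PowerSeries ℤ := PowerSeries.X

/-- The variable `q`, as an element of `ℤ[[x, q]]`. -/
def Q : XQSeries := PowerSeries.C q

/-- The class `𝒮` of series `f(x, q)` with `f(0, q) = 1` and `f(x, 0) = 1`. -/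
def InClassS (f : XQSeries) : Prop :=
  constantCoeff f = 1 ∧ PowerSeries.map (constantCoeff (R := ℤ)) f = 1

/-- The substitution `f(x, q) ↦ f(x q², q)`. -/
def shift (f : XQSeries) : XQSeries := rescale (q ^ 2) f

/-- The matrix of the system of difference equations. The seven series are
`F₀, F₁, F₂, F₃, F₄, F₅, F₇`, in this order, so that the index `6` belongs to `F₇`. -/
def systemMatrix : Matrix (Fin 7) (Fin 7) XQSeries :=
  !![1, x * Q ^ 2, x ^ 2 * Q ^ 4, x * Q, x ^ 2 * Q ^ 2, 0, 0;
     0, x * Q ^ 2, 0,             0,     0,             1, 0;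
     0, 0,         0,             0,     0,             0, 1;
     0, x * Q ^ 2, 0,             x * Q, 0,             1, 0;
     0, 0,         0,             0,     x * Q ^ 2,     0, 1;
     1, x * Q ^ 2, x ^ 2 * Q ^ 4, x * Q, 0,             0, 0;
     1, x * Q ^ 2, x ^ 2 * Q ^ 4, 0,     0,             0, 0]

/-- `F = (F₀, F₁, F₂, F₃, F₄, F₅, F₇)` is a solution, with all entries in the class `𝒮`, of the
system `F(x, q) = M(x, q) F(x q², q)`. -/
def IsSystemSolution (F : Fin 7 → XQSeries) : Prop :=
  (∀ a, InClassS (F a)) ∧ F = systemMatrix.mulVec (fun a => shift (F a))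

/-- The finite `q`-Pochhammer symbol `(qˢ; qˢ)_n = ∏_{t = 1}^{n} (1 - q^{s t})`. -/
def qPoch (s n : ℕ) : PowerSeries ℤ := ∏ t ∈ range n, (1 - q ^ s * (q ^ s) ^ t)

/-- The reciprocal `1 / (qˢ; qˢ)_n` in `ℤ[[q]]`, for `s ≥ 1`. -/
def qPochInv (s n : ℕ) : PowerSeries ℤ := invOfUnit (qPoch s n) 1

theorem qPoch_mul_qPochInv (s n : ℕ) (hs : 1 ≤ s) : qPoch s n * qPochInv s n = 1 := by
  apply mul_invOfUnit
  have h : s ≠ 0 := by omega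
  simp [qPoch, q, map_prod, h]

/-- The exponent of `q` in the numerator of the summand of `S_{A,B,C,D}`. -/
def qExponent (A B C D : ℤ) (i j k l : ℕ) : ℤ :=
  4 * i ^ 2 + 12 * i * j + 8 * i * k + 4 * i * l + 12 * j ^ 2 + 16 * j * k + 8 * j * l
    + 6 * k ^ 2 + 6 * k * l + 2 * l ^ 2 + A * i + B * j + C * k + D * l

/-- The power of `q` in the numerator divided by
`(q²; q²)_i (q²; q²)_j (q; q)_k (q; q)_l`, as a Laurent series in `q`
(for general integers `A, B, C, D` the exponent may be negative). -/
def summand (A B C D : ℤ) (i j k l : ℕ) : LaurentSeries ℤ :=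
  HahnSeries.single (qExponent A B C D i j k l) 1 *
    HahnSeries.ofPowerSeries ℤ ℤ (qPochInv 2 i * qPochInv 2 j * qPochInv 1 k * qPochInv 1 l)

/-- The finite set of all quadruples `(i, j, k, l)` with `2i + 3j + 2k + l = n`. -/
def quads (n : ℕ) : Finset (ℕ × ℕ × ℕ × ℕ) :=
  (range (n + 1) ×ˢ range (n + 1) ×ˢ range (n + 1) ×ˢ range (n + 1)).filter
    fun m => 2 * m.1 + 3 * m.2.1 + 2 * m.2.2.1 + m.2.2.2 = n

theorem mem_quads (n i j k l : ℕ) :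
    (i, j, k, l) ∈ quads n ↔ 2 * i + 3 * j + 2 * k + l = n := by
  simp only [quads, mem_filter, mem_product, mem_range]
  omega

/-- The quadruple sum `S_{A,B,C,D}(x, q)`, a power series in `x` whose coefficients are Laurent
series in `q`: the coefficient of `xⁿ` is the sum of the summands over the finitely many
`(i, j, k, l)` with `2i + 3j + 2k + l = n`. -/
def S (A B C D : ℤ) : PowerSeries (LaurentSeries ℤ) :=
  PowerSeries.mk fun n => ∑ m ∈ quads n, summand A B C D m.1 m.2.1 m.2.2.1 m.2.2.2

/-- The inclusion of `ℤ[[x, q]]` into the power series in `x` over the Laurent series in `q`. -/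
def incl : XQSeries →+* PowerSeries (LaurentSeries ℤ) :=
  PowerSeries.map (HahnSeries.ofPowerSeries ℤ ℤ)

end NandiSums

end

noncomputable section

namespace NandiSums

open PowerSeries Finset

/-! At `x = 0` the matrix becomes triangular in the order `F₀; F₅, F₇; F₁, F₂, F₃, F₄`, and its only
diagonal entry is the 1 of `F₀`. Comparing coefficients of `xⁿ` for `n ≥ 1` thus gives `(1 - q^(2n))
c₀ =` (terms from lower coefficients), after which the other six coefficients are read off. Since `1
- q^(2n)` is a unit of `ℤ[[q]]` and nonzero among Laurent series, this yields existence over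
`ℤ[[q]]` and uniqueness over either ring once the constant terms are fixed (`systemEqs_solution`,
`SystemEqs.unique`).

It remains to exhibit a solution over the Laurent series whose entries include the three quadruple
sums. Replacing `x` by `xq²` only translates the parameters of `S` (`rescale_S`), and each summation
index gives one contiguous relation (`S_sub_S_i`, `S_sub_S_j`, `S_sub_S_k`, `S_sub_S_l`). The system
itself dictates the missing entries: row 3 (numbering the rows by the series) gives `F₂ = F₇(xq²)`;
rows 5 and 7 give `xq F₃(xq²) = F₅ - F₇`; rows 0 and 5 give `F₀ = F₅ + x²q² F₄(xq²)`; row 7 then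
determines `F₄(xq⁴)`. Each remaining row is an explicit combination of contiguous relations with
coefficients in `ℤ[x, q]`. -/

/-- The monomial `qᵐ`, for an integer `m`, in the ring of Laurent series. -/
def qPow (m : ℤ) : LaurentSeries ℤ := HahnSeries.single m 1

theorem qPow_add (m n : ℤ) : qPow (m + n) = qPow m * qPow n := by
  simp [qPow, HahnSeries.single_mul_single]

theorem qPow_zero : qPow 0 = 1 := rfl

theorem qPow_natCast (n : ℕ) : qPow n = qPow 1 ^ n := by
  induction n with
  | zero => simp [qPow_zero]
  | succ n ih => rw [pow_succ, ← ih, Nat.cast_succ, qPow_add]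

theorem ofPowerSeries_q : HahnSeries.ofPowerSeries ℤ ℤ q = qPow 1 :=
  HahnSeries.ofPowerSeries_X

theorem qPow_one_pow_ne_one {n : ℕ} (hn : n ≠ 0) : qPow 1 ^ n ≠ 1 := by
  rw [← qPow_natCast, ← qPow_zero]
  intro h
  have := congrArg (fun f => HahnSeries.coeff f 0) h
  simp [qPow, hn, eq_comm] at this

/-- `1 / (qˢ; qˢ)_n` as a Laurent series. -/
def laurentPochInv (s n : ℕ) : LaurentSeries ℤ := HahnSeries.ofPowerSeries ℤ ℤ (qPochInv s n)

theorem laurentPochInv_succ (s n : ℕ) (hs : 1 ≤ s) :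
    (1 - qPow (s * ((n : ℤ) + 1))) * laurentPochInv s (n + 1) = laurentPochInv s n := by
  have h : (1 - q ^ (s * (n + 1))) * qPochInv s (n + 1) = qPochInv s n := by
    have h1 := qPoch_mul_qPochInv s n hs
    have h2 := qPoch_mul_qPochInv s (n + 1) hs
    have h3 : qPoch s (n + 1) = qPoch s n * (1 - q ^ (s * (n + 1))) := by
      rw [qPoch, prod_range_succ, ← qPoch]; ring
    rw [h3] at h2
    linear_combination (-(1 - q ^ (s * (n + 1))) * qPochInv s (n + 1)) * h1 + qPochInv s n * h2
  have h4 : qPow (s * ((n : ℤ) + 1)) = HahnSeries.ofPowerSeries ℤ ℤ (q ^ (s * (n + 1))) := by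
    rw [map_pow, ofPowerSeries_q, ← qPow_natCast]; push_cast; rfl
  rw [laurentPochInv, laurentPochInv, h4, ← h]
  simp only [map_mul, map_sub, map_one]

theorem summand_eq (A B C D : ℤ) (i j k l : ℕ) :
    summand A B C D i j k l = qPow (qExponent A B C D i j k l) *
      (laurentPochInv 2 i * laurentPochInv 2 j * laurentPochInv 1 k * laurentPochInv 1 l) := by
  simp only [summand, qPow, laurentPochInv, map_mul]

/-! ### Contiguous relations and the shift for the quadruple sums. -/

/-- Reindexing of a sum over `quads n` along an injection `φ` that raises the weight by `w`,
when the terms outside the range of `φ` vanish. -/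
theorem sum_quads_of_step {M : Type*} [AddCommMonoid M] (f g : ℕ × ℕ × ℕ × ℕ → M)
    (φ : ℕ × ℕ × ℕ × ℕ → ℕ × ℕ × ℕ × ℕ) (w : ℕ) (hinj : Function.Injective φ)
    (hφ : ∀ m n, φ m ∈ quads (n + w) ↔ m ∈ quads n)
    (hφ' : ∀ m n, n < w → φ m ∉ quads n)
    (hfg : ∀ m, f (φ m) = g m) (hf : ∀ m, m ∉ Set.range φ → f m = 0) (n : ℕ) :
    ∑ m ∈ quads n, f m = if w ≤ n then ∑ m ∈ quads (n - w), g m else 0 := by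
  split_ifs with h
  · obtain ⟨n, rfl⟩ := Nat.exists_eq_add_of_le' h
    rw [Nat.add_sub_cancel]
    symm
    refine sum_of_injOn φ hinj.injOn (fun m hm => ?_) (fun m hm hm' => hf m ?_)
      (fun m _ => (hfg m).symm)
    · exact (hφ m n).2 hm
    · rintro ⟨m, rfl⟩
      exact hm' ⟨m, (hφ m n).1 hm, rfl⟩
  · refine sum_eq_zero fun m hm => hf m ?_
    rintro ⟨m, rfl⟩
    exact hφ' m n (not_le.1 h) hm

/-- The variable `q` in the power series in `x` over the Laurent series in `q`. -/
def T : PowerSeries (LaurentSeries ℤ) := C (qPow 1)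

theorem S_sub_S {A B C D A' B' C' D' A'' B'' C'' D'' : ℤ} (e w : ℕ)
    (φ : ℕ × ℕ × ℕ × ℕ → ℕ × ℕ × ℕ × ℕ) (hinj : Function.Injective φ)
    (hφ : ∀ m n, φ m ∈ quads (n + w) ↔ m ∈ quads n)
    (hφ' : ∀ m n, n < w → φ m ∉ quads n)
    (hfg : ∀ i j k l, let m := φ (i, j, k, l)
      summand A B C D m.1 m.2.1 m.2.2.1 m.2.2.2 - summand A' B' C' D' m.1 m.2.1 m.2.2.1 m.2.2.2 =
        qPow e * summand A'' B'' C'' D'' i j k l)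
    (hf : ∀ i j k l, (i, j, k, l) ∉ Set.range φ →
      summand A B C D i j k l = summand A' B' C' D' i j k l) :
    S A B C D - S A' B' C' D' = X ^ w * T ^ e * S A'' B'' C'' D'' := by
  ext1 n
  rw [T, ← map_pow, ← qPow_natCast, mul_assoc, coeff_X_pow_mul', coeff_C_mul]
  simp only [S, map_sub, coeff_mk, ← sum_sub_distrib, mul_sum]
  refine sum_quads_of_step _ _ φ w hinj hφ hφ' (fun m => hfg _ _ _ _) ?_ n
  rintro ⟨i, j, k, l⟩ hm
  exact sub_eq_zero.2 (hf i j k l hm)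

/-- Raising `A` by 2 multiplies each summand by `q^(2i)`. The factor `1 - q^(2i)` in the difference
kills `i = 0` and otherwise cancels the last factor of `(q²; q²)_i`. After `i ↦ i + 1`, the cross
terms of the quadratic form become the new linear parameters. The relations for `j`, `k`, `l` arise
in the same way. -/
theorem S_sub_S_i (A B C D : ℤ) (e : ℕ) (he : 4 + A = e) : S A B C D - S (A + 2) B C D =
    X ^ 2 * T ^ e * S (A + 8) (B + 12) (C + 8) (D + 4) := by
  refine S_sub_S e 2 (fun m => (m.1 + 1, m.2.1, m.2.2.1, m.2.2.2)) ?_ ?_ ?_ ?_ ?_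
  · rintro ⟨i, j, k, l⟩ ⟨i', j', k', l'⟩ h; simpa using h
  · rintro ⟨i, j, k, l⟩ n; simp only [mem_quads]; omega
  · rintro ⟨i, j, k, l⟩ n; simp only [mem_quads]; omega
  · intro i j k l
    simp only [summand_eq, ← laurentPochInv_succ 2 i one_le_two, ← he]
    have h1 : qPow (qExponent (A + 2) B C D (i + 1) j k l) =
        qPow (qExponent A B C D (i + 1) j k l) * qPow ((2 : ℕ) * ((i : ℤ) + 1)) := by
      rw [← qPow_add]; congr 1; simp only [qExponent]; push_cast; ring
    have h2 : qPow (qExponent A B C D (i + 1) j k l) =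
        qPow (4 + A) * qPow (qExponent (A + 8) (B + 12) (C + 8) (D + 4) i j k l) := by
      rw [← qPow_add]; congr 1; simp only [qExponent]; push_cast; ring
    rw [h1, h2]; ring
  · rintro (_ | i) j k l h
    · simp [summand_eq, qExponent]
    · exact absurd ⟨(i, j, k, l), rfl⟩ h

theorem S_sub_S_j (A B C D : ℤ) (e : ℕ) (he : 12 + B = e) : S A B C D - S A (B + 2) C D =
    X ^ 3 * T ^ e * S (A + 12) (B + 24) (C + 16) (D + 8) := by
  refine S_sub_S e 3 (fun m => (m.1, m.2.1 + 1, m.2.2.1, m.2.2.2)) ?_ ?_ ?_ ?_ ?_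
  · rintro ⟨i, j, k, l⟩ ⟨i', j', k', l'⟩ h; simpa using h
  · rintro ⟨i, j, k, l⟩ n; simp only [mem_quads]; omega
  · rintro ⟨i, j, k, l⟩ n; simp only [mem_quads]; omega
  · intro i j k l
    simp only [summand_eq, ← laurentPochInv_succ 2 j one_le_two, ← he]
    have h1 : qPow (qExponent A (B + 2) C D i (j + 1) k l) =
        qPow (qExponent A B C D i (j + 1) k l) * qPow ((2 : ℕ) * ((j : ℤ) + 1)) := by
      rw [← qPow_add]; congr 1; simp only [qExponent]; push_cast; ring
    have h2 : qPow (qExponent A B C D i (j + 1) k l) =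
        qPow (12 + B) * qPow (qExponent (A + 12) (B + 24) (C + 16) (D + 8) i j k l) := by
      rw [← qPow_add]; congr 1; simp only [qExponent]; push_cast; ring
    rw [h1, h2]; ring
  · rintro i (_ | j) k l h
    · simp [summand_eq, qExponent]
    · exact absurd ⟨(i, j, k, l), rfl⟩ h

theorem S_sub_S_k (A B C D : ℤ) (e : ℕ) (he : 6 + C = e) : S A B C D - S A B (C + 1) D =
    X ^ 2 * T ^ e * S (A + 8) (B + 16) (C + 12) (D + 6) := by
  refine S_sub_S e 2 (fun m => (m.1, m.2.1, m.2.2.1 + 1, m.2.2.2)) ?_ ?_ ?_ ?_ ?_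
  · rintro ⟨i, j, k, l⟩ ⟨i', j', k', l'⟩ h; simpa using h
  · rintro ⟨i, j, k, l⟩ n; simp only [mem_quads]; omega
  · rintro ⟨i, j, k, l⟩ n; simp only [mem_quads]; omega
  · intro i j k l
    simp only [summand_eq, ← laurentPochInv_succ 1 k le_rfl, ← he]
    have h1 : qPow (qExponent A B (C + 1) D i j (k + 1) l) =
        qPow (qExponent A B C D i j (k + 1) l) * qPow ((1 : ℕ) * ((k : ℤ) + 1)) := by
      rw [← qPow_add]; congr 1; simp only [qExponent]; push_cast; ring
    have h2 : qPow (qExponent A B C D i j (k + 1) l) =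
        qPow (6 + C) * qPow (qExponent (A + 8) (B + 16) (C + 12) (D + 6) i j k l) := by
      rw [← qPow_add]; congr 1; simp only [qExponent]; push_cast; ring
    rw [h1, h2]; ring
  · rintro i j (_ | k) l h
    · simp [summand_eq, qExponent]
    · exact absurd ⟨(i, j, k, l), rfl⟩ h

theorem S_sub_S_l (A B C D : ℤ) (e : ℕ) (he : 2 + D = e) : S A B C D - S A B C (D + 1) =
    X ^ 1 * T ^ e * S (A + 4) (B + 8) (C + 6) (D + 4) := by
  refine S_sub_S e 1 (fun m => (m.1, m.2.1, m.2.2.1, m.2.2.2 + 1)) ?_ ?_ ?_ ?_ ?_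
  · rintro ⟨i, j, k, l⟩ ⟨i', j', k', l'⟩ h; simpa using h
  · rintro ⟨i, j, k, l⟩ n; simp only [mem_quads]; omega
  · rintro ⟨i, j, k, l⟩ n; simp only [mem_quads]; omega
  · intro i j k l
    simp only [summand_eq, ← laurentPochInv_succ 1 l le_rfl, ← he]
    have h1 : qPow (qExponent A B C (D + 1) i j k (l + 1)) =
        qPow (qExponent A B C D i j k (l + 1)) * qPow ((1 : ℕ) * ((l : ℤ) + 1)) := by
      rw [← qPow_add]; congr 1; simp only [qExponent]; push_cast; ring
    have h2 : qPow (qExponent A B C D i j k (l + 1)) =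
        qPow (2 + D) * qPow (qExponent (A + 4) (B + 8) (C + 6) (D + 4) i j k l) := by
      rw [← qPow_add]; congr 1; simp only [qExponent]; push_cast; ring
    rw [h1, h2]; ring
  · rintro i j k (_ | l) h
    · simp [summand_eq, qExponent]
    · exact absurd ⟨(i, j, k, l), rfl⟩ h

/-- The power of `x` is `2i + 3j + 2k + l`, so `x ↦ xq²` contributes the linear form `4i + 6j + 4k +
2l` to the exponent of `q`. -/
theorem rescale_S (A B C D : ℤ) :
    rescale (qPow 1 ^ 2) (S A B C D) = S (A + 4) (B + 6) (C + 4) (D + 2) := by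
  ext1 n
  simp only [S, coeff_rescale, coeff_mk, mul_sum]
  refine sum_congr rfl ?_
  rintro ⟨i, j, k, l⟩ hm
  rw [mem_quads] at hm
  simp only [summand_eq]
  rw [← mul_assoc, ← pow_mul, ← qPow_natCast, ← qPow_add]
  congr 2
  simp only [qExponent, ← hm]
  push_cast
  ring

theorem constantCoeff_S (A B C D : ℤ) : constantCoeff (S A B C D) = 1 := by
  have h : quads 0 = {(0, 0, 0, 0)} := by decide
  rw [← coeff_zero_eq_constantCoeff_apply, S, coeff_mk, h, sum_singleton, summand_eq]
  have h0 (s : ℕ) : laurentPochInv s 0 = 1 := by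
    have : qPochInv s 0 = 1 := by
      have h := mul_invOfUnit (qPoch s 0) 1 (by simp [qPoch])
      simpa [qPoch, qPochInv] using h
    simp [laurentPochInv, this]
  simp [h0, qExponent, qPow_zero]

/-! ### The system over a general coefficient ring, and uniqueness. -/

/-- The system of difference equations `F(x) = M(x) F(x p²)`, row by row, over a coefficient
ring with a distinguished element `p` in the role of `q`. -/
structure SystemEqs {R : Type*} [CommRing R] (p : R) (F : Fin 7 → PowerSeries R) : Prop where
  eq0 : F 0 = rescale (p ^ 2) (F 0) + X * C p ^ 2 * rescale (p ^ 2) (F 1)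
    + X ^ 2 * C p ^ 4 * rescale (p ^ 2) (F 2) + X * C p * rescale (p ^ 2) (F 3)
    + X ^ 2 * C p ^ 2 * rescale (p ^ 2) (F 4)
  eq1 : F 1 = X * C p ^ 2 * rescale (p ^ 2) (F 1) + rescale (p ^ 2) (F 5)
  eq2 : F 2 = rescale (p ^ 2) (F 6)
  eq3 : F 3 = X * C p ^ 2 * rescale (p ^ 2) (F 1) + X * C p * rescale (p ^ 2) (F 3)
    + rescale (p ^ 2) (F 5)
  eq4 : F 4 = X * C p ^ 2 * rescale (p ^ 2) (F 4) + rescale (p ^ 2) (F 6)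
  eq5 : F 5 = rescale (p ^ 2) (F 0) + X * C p ^ 2 * rescale (p ^ 2) (F 1)
    + X ^ 2 * C p ^ 4 * rescale (p ^ 2) (F 2) + X * C p * rescale (p ^ 2) (F 3)
  eq6 : F 6 = rescale (p ^ 2) (F 0) + X * C p ^ 2 * rescale (p ^ 2) (F 1)
    + X ^ 2 * C p ^ 4 * rescale (p ^ 2) (F 2)

theorem eq_mulVec_iff_systemEqs (F : Fin 7 → XQSeries) :
    F = systemMatrix.mulVec (fun a => shift (F a)) ↔ SystemEqs q F := by
  have h : F = systemMatrix.mulVec (fun a => shift (F a)) ↔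
      ∀ a, F a = systemMatrix.mulVec (fun a => shift (F a)) a := funext_iff
  rw [h]
  simp only [Fin.forall_fin_succ, systemMatrix, Matrix.mulVec, dotProduct, Fin.sum_univ_succ]
  simp [shift, x, Q, ← add_assoc, -map_pow]
  constructor
  · rintro ⟨h0, h1, h2, h3, h4, h5, h6⟩
    exact ⟨h0, h1, h2, h3, h4, h5, h6⟩
  · rintro ⟨h0, h1, h2, h3, h4, h5, h6⟩
    exact ⟨h0, h1, h2, h3, h4, h5, h6⟩

theorem rescale_map {R R' : Type*} [CommRing R] [CommRing R'] (f : R →+* R') (a : R)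
    (g : PowerSeries R) : rescale (f a) (map f g) = map f (rescale a g) := by
  ext n; simp

theorem SystemEqs.map {R R' : Type*} [CommRing R] [CommRing R'] (f : R →+* R') {p : R}
    {F : Fin 7 → PowerSeries R} (h : SystemEqs p F) :
    SystemEqs (f p) (fun a => PowerSeries.map f (F a)) := by
  obtain ⟨h0, h1, h2, h3, h4, h5, h6⟩ := h
  constructor <;> simp only [← map_pow f, rescale_map]
  · conv_lhs => rw [h0]
    simp
  · conv_lhs => rw [h1]
    simp
  · conv_lhs => rw [h2]
  · conv_lhs => rw [h3]
    simp
  · conv_lhs => rw [h4]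
    simp
  · conv_lhs => rw [h5]
    simp
  · conv_lhs => rw [h6]
    simp

theorem coeff_X_mul_C_mul {R : Type*} [CommRing R] (p : R) (i n : ℕ) (g : PowerSeries R) :
    coeff (n + 1) (X * C p ^ i * g) = p ^ i * coeff n g := by
  rw [mul_assoc, coeff_succ_X_mul, ← map_pow, coeff_C_mul]

/-- Strong induction on the power of `x`: entries carrying a factor `x` or `x²` see only earlier
coefficients, and the `x`-free part of the matrix is triangular. -/
theorem SystemEqs.unique {R : Type*} [CommRing R] [IsDomain R] {p : R}
    (hp : ∀ n : ℕ, n ≠ 0 → p ^ n ≠ 1) {F G : Fin 7 → PowerSeries R} (hF : SystemEqs p F)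
    (hG : SystemEqs p G) (h0 : ∀ a, constantCoeff (F a) = constantCoeff (G a)) : F = G := by
  have key : ∀ n a, coeff n (F a) = coeff n (G a) := by
    intro n
    induction n using Nat.strong_induction_on with
    | _ n ih =>
      rcases n with _ | n
      · simpa using h0
      have e1 : ∀ i a, coeff (n + 1) (X * C p ^ i * rescale (p ^ 2) (F a)) =
          coeff (n + 1) (X * C p ^ i * rescale (p ^ 2) (G a)) := by
        intro i a
        rw [coeff_X_mul_C_mul, coeff_X_mul_C_mul, coeff_rescale, coeff_rescale,
          ih n (Nat.lt_succ_self n)]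
      have e1' : ∀ a, coeff (n + 1) (X * C p * rescale (p ^ 2) (F a)) =
          coeff (n + 1) (X * C p * rescale (p ^ 2) (G a)) := by
        simpa using e1 1
      have e2 : ∀ i a, coeff (n + 1) (X ^ 2 * C p ^ i * rescale (p ^ 2) (F a)) =
          coeff (n + 1) (X ^ 2 * C p ^ i * rescale (p ^ 2) (G a)) := by
        intro i a
        rw [mul_assoc, mul_assoc, coeff_X_pow_mul', coeff_X_pow_mul']
        split_ifs with h
        · rw [← map_pow, coeff_C_mul, coeff_C_mul, coeff_rescale, coeff_rescale,
            ih _ (by omega)]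
        · rfl
      have e3 (a) : coeff (n + 1) (rescale (p ^ 2) (F a)) - coeff (n + 1) (rescale (p ^ 2) (G a)) =
          p ^ (2 * (n + 1)) * (coeff (n + 1) (F a) - coeff (n + 1) (G a)) := by
        rw [coeff_rescale, coeff_rescale, pow_mul]; ring
      obtain ⟨f0, f1, f2, f3, f4, f5, f6⟩ := hF
      obtain ⟨g0, g1, g2, g3, g4, g5, g6⟩ := hG
      have d {u v : PowerSeries R} (h : u = v) : coeff (n + 1) u = coeff (n + 1) v := by rw [h]
      replace f0 := d f0; replace f1 := d f1; replace f2 := d f2; replace f3 := d f3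
      replace f4 := d f4; replace f5 := d f5; replace f6 := d f6
      replace g0 := d g0; replace g1 := d g1; replace g2 := d g2; replace g3 := d g3
      replace g4 := d g4; replace g5 := d g5; replace g6 := d g6
      simp only [map_add, e1, e1', e2] at f0 f1 f2 f3 f4 f5 f6 g0 g1 g2 g3 g4 g5 g6
      -- Row 0 is the only one whose `x`-free part involves its own unknown, so only here must a
      -- factor `1 - p^(2(n+1))` be cancelled; the other rows follow in triangular order.
      have z0 : coeff (n + 1) (F 0) = coeff (n + 1) (G 0) := by
        have h : (1 - p ^ (2 * (n + 1))) * (coeff (n + 1) (F 0) - coeff (n + 1) (G 0)) = 0 := by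
          linear_combination f0 - g0 + e3 0
        rcases mul_eq_zero.1 h with h | h
        · exact absurd (sub_eq_zero.1 h).symm (hp _ (by omega))
        · exact sub_eq_zero.1 h
      have z5 : coeff (n + 1) (F 5) = coeff (n + 1) (G 5) := by
        linear_combination f5 - g5 + e3 0 + p ^ (2 * (n + 1)) * z0
      have z6 : coeff (n + 1) (F 6) = coeff (n + 1) (G 6) := by
        linear_combination f6 - g6 + e3 0 + p ^ (2 * (n + 1)) * z0
      have z1 : coeff (n + 1) (F 1) = coeff (n + 1) (G 1) := by
        linear_combination f1 - g1 + e3 5 + p ^ (2 * (n + 1)) * z5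
      have z2 : coeff (n + 1) (F 2) = coeff (n + 1) (G 2) := by
        linear_combination f2 - g2 + e3 6 + p ^ (2 * (n + 1)) * z6
      have z3 : coeff (n + 1) (F 3) = coeff (n + 1) (G 3) := by
        linear_combination f3 - g3 + e3 5 + p ^ (2 * (n + 1)) * z5
      have z4 : coeff (n + 1) (F 4) = coeff (n + 1) (G 4) := by
        linear_combination f4 - g4 + e3 6 + p ^ (2 * (n + 1)) * z6
      intro a
      fin_cases a <;> assumption
  funext a
  ext1 n
  exact key n a

/-! ### Existence of a solution in the class `𝒮`. -/

/-- The coefficients of `xⁿ` in a solution of the system, in terms of those (`b`) of `xⁿ⁻¹` and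
those (`a`) of `xⁿ⁻²`, each multiplied by the factor that comes from the shift. -/
def nextCoeff (n : ℕ) (b a : Fin 7 → PowerSeries ℤ) : Fin 7 → PowerSeries ℤ :=
  let p := q ^ (2 * n)
  let c0 := invOfUnit (1 - p) 1 * (q ^ 2 * b 1 + q ^ 4 * a 2 + q * b 3 + q ^ 2 * a 4)
  let c5 := p * c0 + q ^ 2 * b 1 + q ^ 4 * a 2 + q * b 3
  let c6 := p * c0 + q ^ 2 * b 1 + q ^ 4 * a 2
  ![c0, q ^ 2 * b 1 + p * c5, p * c6, q ^ 2 * b 1 + q * b 3 + p * c5, q ^ 2 * b 4 + p * c6, c5, c6]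

/-- The coefficients of the solution of the system. -/
def solutionCoeff : ℕ → Fin 7 → PowerSeries ℤ
  | 0 => 1
  -- The coefficients of `x⁰` are all 1 with shift factor `(q²)⁰ = 1`; those of `x⁻¹` are absent,
  -- hence 0.
  | 1 => nextCoeff 1 1 0
  | n + 2 => nextCoeff (n + 2) (fun a => (q ^ 2) ^ (n + 1) * solutionCoeff (n + 1) a)
      (fun a => (q ^ 2) ^ n * solutionCoeff n a)

/-- The solution of the system. -/
def solution (a : Fin 7) : XQSeries := PowerSeries.mk fun n => solutionCoeff n a

theorem one_sub_q_pow_mul_inv (n : ℕ) (hn : n ≠ 0) :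
    (1 - q ^ (2 * n)) * invOfUnit (1 - q ^ (2 * n)) 1 = 1 := by
  apply mul_invOfUnit
  simp [q, hn]

theorem nextCoeff_zero (n : ℕ) (hn : n ≠ 0) (b a : Fin 7 → PowerSeries ℤ) :
    nextCoeff n b a 0 = q ^ (2 * n) * nextCoeff n b a 0 + q ^ 2 * b 1 + q ^ 4 * a 2 + q * b 3
      + q ^ 2 * a 4 := by
  have h := one_sub_q_pow_mul_inv n hn
  simp only [nextCoeff, Matrix.cons_val_zero]
  linear_combination (q ^ 2 * b 1 + q ^ 4 * a 2 + q * b 3 + q ^ 2 * a 4) * h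

theorem systemEqs_solution : SystemEqs q solution := by
  have hC (i : ℕ) (n : ℕ) (g : XQSeries) :
      coeff (n + 1) (X * C q ^ i * g) = q ^ i * coeff n g := coeff_X_mul_C_mul _ _ _ _
  have hC' (n : ℕ) (g : XQSeries) : coeff (n + 1) (X * C q * g) = q * coeff n g := by
    simpa using hC 1 n g
  have hD (i : ℕ) (n : ℕ) (g : XQSeries) :
      coeff (n + 2) (X ^ 2 * C q ^ i * g) = q ^ i * coeff n g := by
    rw [mul_assoc, coeff_X_pow_mul, ← map_pow, coeff_C_mul]
  have hD' (i : ℕ) (g : XQSeries) : coeff 1 (X ^ 2 * C q ^ i * g) = 0 := by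
    rw [mul_assoc, coeff_X_pow_mul']; simp
  have hC1 (i : ℕ) (g : XQSeries) :
      coeff 1 (X * C q ^ i * g) = q ^ i * coeff 0 g := hC i 0 g
  have hC1' (g : XQSeries) : coeff 1 (X * C q * g) = q * coeff 0 g := hC' 0 g
  have hp (n : ℕ) : (q ^ 2) ^ n = q ^ (2 * n) := (pow_mul _ _ _).symm
  constructor <;> ext1 n <;> rcases n with _ | _ | n
  all_goals
    simp only [map_add, zero_add, hC, hC', hD, hD', coeff_rescale, add_zero]
    simp only [solution, coeff_mk, hp]
  case eq0.succ.zero =>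
    simpa [solutionCoeff] using nextCoeff_zero 1 one_ne_zero 1 0
  case eq0.succ.succ =>
    have h := nextCoeff_zero (n + 2) (by omega)
      (fun a => (q ^ 2) ^ (n + 1) * solutionCoeff (n + 1) a)
      (fun a => (q ^ 2) ^ n * solutionCoeff n a)
    simp only [hp] at h
    simpa only [solutionCoeff, hp] using h
  all_goals simp [solutionCoeff, nextCoeff, hp]

theorem constantCoeff_solution (a : Fin 7) : constantCoeff (solution a) = 1 := by
  rw [← coeff_zero_eq_constantCoeff_apply, solution, coeff_mk]
  rfl

/-- For `f(x, 0) = 1`, reduce the system modulo `q`: each row keeps exactly one entry, equal to 1,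
and the shift becomes `x ↦ 0`, which leaves only the constant term 1. -/
theorem isSystemSolution_solution : IsSystemSolution solution := by
  refine ⟨fun a => ⟨constantCoeff_solution a, ?_⟩,
    (eq_mulVec_iff_systemEqs _).2 systemEqs_solution⟩
  have h := systemEqs_solution.map (constantCoeff (R := ℤ))
  have hq : constantCoeff q = (0 : ℤ) := constantCoeff_X
  have hr (b : Fin 7) :
      rescale (0 : ℤ) (PowerSeries.map constantCoeff (solution b)) = 1 := by
    rw [rescale_zero_apply]
    simp [← coeff_zero_eq_constantCoeff_apply, coeff_map, solution, solutionCoeff]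
  rw [hq] at h
  obtain ⟨h0, h1, h2, h3, h4, h5, h6⟩ := h
  simp only [hr, map_zero, zero_pow, ne_eq, OfNat.ofNat_ne_zero, not_false_eq_true, mul_zero,
    zero_mul, add_zero, zero_add] at h0 h1 h2 h3 h4 h5 h6
  fin_cases a <;> assumption

/-! ### Passage to Laurent series in `q`, and the shift there. -/

theorem ofPowerSeries_constantCoeff_incl (f : XQSeries) :
    constantCoeff (incl f) = HahnSeries.ofPowerSeries ℤ ℤ (constantCoeff f) := by
  rw [← coeff_zero_eq_constantCoeff_apply, ← coeff_zero_eq_constantCoeff_apply, incl, coeff_map]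

theorem incl_injective : Function.Injective incl :=
  PowerSeries.map_injective _ HahnSeries.ofPowerSeries_injective

theorem IsSystemSolution.incl_eq {F : Fin 7 → XQSeries} (hF : IsSystemSolution F)
    {G : Fin 7 → PowerSeries (LaurentSeries ℤ)} (hG : SystemEqs (qPow 1) G)
    (hG0 : ∀ a, constantCoeff (G a) = 1) (a : Fin 7) : incl (F a) = G a := by
  have h := ((eq_mulVec_iff_systemEqs F).1 hF.2).map (HahnSeries.ofPowerSeries ℤ ℤ)
  rw [ofPowerSeries_q] at h
  refine congrFun (h.unique (fun n hn => qPow_one_pow_ne_one hn) hG fun b => ?_) a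
  rw [hG0]
  exact (ofPowerSeries_constantCoeff_incl (F b)).trans (by rw [(hF.1 b).1, map_one])

theorem existsUnique_isSystemSolution : ∃! F : Fin 7 → XQSeries, IsSystemSolution F := by
  refine ⟨solution, isSystemSolution_solution, fun F hF => funext fun a => incl_injective ?_⟩
  refine hF.incl_eq (G := fun a => incl (solution a)) ?_ (fun b => ?_) a
  · rw [← ofPowerSeries_q]
    exact systemEqs_solution.map _
  · rw [ofPowerSeries_constantCoeff_incl, constantCoeff_solution, map_one]

theorem rescale_T (a : LaurentSeries ℤ) : rescale a T = T := by
  ext n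
  rcases n with _ | n <;> simp [T, coeff_C]

theorem rescale_qPow_X : rescale (qPow 1 ^ 2) (X : PowerSeries (LaurentSeries ℤ)) = X * T ^ 2 := by
  rw [rescale_X, map_pow, T, mul_comm]

theorem rescale_qPow_injective : Function.Injective (rescale (qPow 1 ^ 2)) := by
  -- Over the Laurent series `q` is invertible, so `x ↦ xq⁻²` undoes the shift.
  refine Function.LeftInverse.injective (g := rescale (qPow (-2))) fun f => ?_
  rw [rescale_rescale, ← qPow_natCast, ← qPow_add]
  simp [qPow_zero]

theorem T_ne_zero : T ≠ 0 := by
  rw [T, Ne, map_eq_zero_iff _ C_injective]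
  exact HahnSeries.single_ne_zero one_ne_zero

/-! ### Certificates for the rows from contiguous relations. -/

/-- This is the row of `F₁`, with `F₁(xq²)` and `F₅(xq²)` already written as translated sums. -/
theorem S_eq_add_one :
    S 2 2 1 0 = X * T ^ 2 * S 6 8 5 2 + S 4 4 2 1 := by
  have h1 : S 2 4 2 1 - S 4 4 2 1 =
      X ^ 2 * T ^ 6 * S 10 16 10 5 :=
    S_sub_S_i 2 4 2 1 6 rfl
  have h2 : S 2 0 0 (-1) - S 2 2 0 (-1) =
      X ^ 3 * T ^ 12 * S 14 24 16 7 :=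
    S_sub_S_j 2 0 0 (-1) 12 rfl
  have h3 : S 2 0 0 0 - S 2 2 0 0 =
      X ^ 3 * T ^ 12 * S 14 24 16 8 :=
    S_sub_S_j 2 0 0 0 12 rfl
  have h4 : S 2 2 1 (-1) - S 2 4 1 (-1) =
      X ^ 3 * T ^ 14 * S 14 26 17 7 :=
    S_sub_S_j 2 2 1 (-1) 14 rfl
  have h5 : S 2 2 1 0 - S 2 4 1 0 =
      X ^ 3 * T ^ 14 * S 14 26 17 8 :=
    S_sub_S_j 2 2 1 0 14 rfl
  have h6 : S 2 2 0 (-1) - S 2 2 1 (-1) =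
      X ^ 2 * T ^ 6 * S 10 18 12 5 :=
    S_sub_S_k 2 2 0 (-1) 6 rfl
  have h7 : S 2 2 0 0 - S 2 2 1 0 =
      X ^ 2 * T ^ 6 * S 10 18 12 6 :=
    S_sub_S_k 2 2 0 0 6 rfl
  have h8 : S 2 4 1 1 - S 2 4 2 1 =
      X ^ 2 * T ^ 7 * S 10 20 13 7 :=
    S_sub_S_k 2 4 1 1 7 rfl
  have h9 : S 6 8 4 1 - S 6 8 5 1 =
      X ^ 2 * T ^ 10 * S 14 24 16 7 :=
    S_sub_S_k 6 8 4 1 10 rfl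
  have h10 : S 6 8 4 2 - S 6 8 5 2 =
      X ^ 2 * T ^ 10 * S 14 24 16 8 :=
    S_sub_S_k 6 8 4 2 10 rfl
  have h11 : S 6 8 5 3 - S 6 8 6 3 =
      X ^ 2 * T ^ 11 * S 14 24 17 9 :=
    S_sub_S_k 6 8 5 3 11 rfl
  have h12 : S 6 10 5 1 - S 6 10 6 1 =
      X ^ 2 * T ^ 11 * S 14 26 17 7 :=
    S_sub_S_k 6 10 5 1 11 rfl
  have h13 : S 6 10 5 2 - S 6 10 6 2 =
      X ^ 2 * T ^ 11 * S 14 26 17 8 :=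
    S_sub_S_k 6 10 5 2 11 rfl
  have h14 : S 6 10 5 3 - S 6 10 6 3 =
      X ^ 2 * T ^ 11 * S 14 26 17 9 :=
    S_sub_S_k 6 10 5 3 11 rfl
  have h15 : S 2 0 0 (-1) - S 2 0 0 0 =
      X ^ 1 * T ^ 1 * S 6 8 6 3 :=
    S_sub_S_l 2 0 0 (-1) 1 rfl
  have h16 : S 2 4 1 (-1) - S 2 4 1 0 =
      X ^ 1 * T ^ 1 * S 6 12 7 3 :=
    S_sub_S_l 2 4 1 (-1) 1 rfl
  have h17 : S 2 4 1 0 - S 2 4 1 1 =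
      X ^ 1 * T ^ 2 * S 6 12 7 4 :=
    S_sub_S_l 2 4 1 0 2 rfl
  have h18 : S 6 8 4 1 - S 6 8 4 2 =
      X ^ 1 * T ^ 3 * S 10 16 10 5 :=
    S_sub_S_l 6 8 4 1 3 rfl
  have h19 : S 6 8 5 1 - S 6 8 5 2 =
      X ^ 1 * T ^ 3 * S 10 16 11 5 :=
    S_sub_S_l 6 8 5 1 3 rfl
  have h20 : S 6 8 5 2 - S 6 8 5 3 =
      X ^ 1 * T ^ 4 * S 10 16 11 6 :=
    S_sub_S_l 6 8 5 2 4 rfl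
  have h21 : S 6 10 5 1 - S 6 10 5 2 =
      X ^ 1 * T ^ 3 * S 10 18 11 5 :=
    S_sub_S_l 6 10 5 1 3 rfl
  have h22 : S 6 10 5 2 - S 6 10 5 3 =
      X ^ 1 * T ^ 4 * S 10 18 11 6 :=
    S_sub_S_l 6 10 5 2 4 rfl
  have h23 : S 6 10 6 1 - S 6 10 6 2 =
      X ^ 1 * T ^ 3 * S 10 18 12 5 :=
    S_sub_S_l 6 10 6 1 3 rfl
  have h24 : S 6 10 6 2 - S 6 10 6 3 =
      X ^ 1 * T ^ 4 * S 10 18 12 6 :=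
    S_sub_S_l 6 10 6 2 4 rfl
  have h25 : S 6 12 7 3 - S 6 12 7 4 =
      X ^ 1 * T ^ 5 * S 10 20 13 7 :=
    S_sub_S_l 6 12 7 3 5 rfl
  have h26 : S 10 16 11 5 - S 10 16 11 6 =
      X ^ 1 * T ^ 7 * S 14 24 17 9 :=
    S_sub_S_l 10 16 11 5 7 rfl
  have h27 : S 10 18 11 5 - S 10 18 11 6 =
      X ^ 1 * T ^ 7 * S 14 26 17 9 :=
    S_sub_S_l 10 18 11 5 7 rfl
  linear_combination h1 + (-T) * h2 + (T) * h3 + (-T) * h4 + (1 + T) * h5 + (-T) * h6 + (T) * h7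
    + h8 + (T ^ 3) * X * h9 + (-T ^ 3) * X * h10 + (-T ^ 2) * X * h11 + (T ^ 4) * X * h12
    + (-T ^ 3 + -T ^ 4) * X * h13 + (T ^ 3) * X * h14 + (T) * h15 + (-T) * h16 + h17
    + (-T ^ 3) * X * h18 + (T ^ 3) * X * h19 + (-T ^ 2) * X * h20 + (-T ^ 4) * X * h21
    + (T ^ 3) * X * h22 + (T ^ 4) * X * h23 + (-T ^ 3) * X * h24 + (-T ^ 2) * X * h25
    + (T ^ 6) * X ^ 2 * h26 + (-T ^ 7) * X ^ 2 * h27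

/-- The right side is `xq F₃(xq²)`; dividing by `xq` and undoing the shift produces `seriesThree`.
The relations telescope along a path of parameters from `F₅` to `F₇`. -/
theorem S_sub_S_five_six :
    S 0 (-2) (-2) (-1) - S 0 0 0 0 =
      X * T * S 4 6 4 3 + X ^ 3 * T ^ 10 * S 12 22 14 8 + X ^ 2 * T ^ 4 * S 8 16 10 6
      + X ^ 2 * T ^ 5 * S 8 16 11 6 := by
  have h1 : S 0 (-2) (-2) 0 - S 0 0 (-2) 0 =
      X ^ 3 * T ^ 10 * S 12 22 14 8 :=
    S_sub_S_j 0 (-2) (-2) 0 10 rfl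
  have h2 : S 0 0 (-1) 0 - S 0 0 0 0 =
      X ^ 2 * T ^ 5 * S 8 16 11 6 :=
    S_sub_S_k 0 0 (-1) 0 5 rfl
  have h3 : S 0 0 (-2) 0 - S 0 0 (-1) 0 =
      X ^ 2 * T ^ 4 * S 8 16 10 6 :=
    S_sub_S_k 0 0 (-2) 0 4 rfl
  have h4 : S 0 (-2) (-2) (-1) - S 0 (-2) (-2) 0 =
      X ^ 1 * T ^ 1 * S 4 6 4 3 :=
    S_sub_S_l 0 (-2) (-2) (-1) 1 rfl
  linear_combination h1 + h2 + h3 + h4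

/-- This is the row of `F₃`, with `xq F₃(xq²)` expanded by `S_sub_S_five_six`. -/
theorem S_eq_add_three :
    S 0 0 0 1 + X ^ 2 * T ^ 5 * S 8 16 10 6 + X * T * S 4 10 6 4 + X * T ^ 2 * S 4 10 7 4 =
      X * T ^ 2 * S 6 8 5 2 + S 4 4 2 1 + X * T * S 4 6 4 3 + X ^ 3 * T ^ 10 * S 12 22 14 8
      + X ^ 2 * T ^ 4 * S 8 16 10 6 + X ^ 2 * T ^ 5 * S 8 16 11 6 := by
  have h1 : S 0 2 1 1 - S 2 2 1 1 =
      X ^ 2 * T ^ 4 * S 8 14 9 5 :=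
    S_sub_S_i 0 2 1 1 4 rfl
  have h2 : S 4 10 7 4 - S 6 10 7 4 =
      X ^ 2 * T ^ 8 * S 12 22 15 8 :=
    S_sub_S_i 4 10 7 4 8 rfl
  have h3 : S 0 (-2) (-1) (-1) - S 0 0 (-1) (-1) =
      X ^ 3 * T ^ 10 * S 12 22 15 7 :=
    S_sub_S_j 0 (-2) (-1) (-1) 10 rfl
  have h4 : S 0 0 0 (-1) - S 0 2 0 (-1) =
      X ^ 3 * T ^ 12 * S 12 24 16 7 :=
    S_sub_S_j 0 0 0 (-1) 12 rfl
  have h5 : S 0 0 0 0 - S 0 2 0 0 =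
      X ^ 3 * T ^ 12 * S 12 24 16 8 :=
    S_sub_S_j 0 0 0 0 12 rfl
  have h6 : S 0 0 0 1 - S 0 2 0 1 =
      X ^ 3 * T ^ 12 * S 12 24 16 9 :=
    S_sub_S_j 0 0 0 1 12 rfl
  have h7 : S 0 (-2) (-2) (-1) - S 0 (-2) (-1) (-1) =
      X ^ 2 * T ^ 4 * S 8 14 10 5 :=
    S_sub_S_k 0 (-2) (-2) (-1) 4 rfl
  have h8 : S 0 0 (-1) (-1) - S 0 0 0 (-1) =
      X ^ 2 * T ^ 5 * S 8 16 11 5 :=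
    S_sub_S_k 0 0 (-1) (-1) 5 rfl
  have h9 : S 0 2 0 1 - S 0 2 1 1 =
      X ^ 2 * T ^ 6 * S 8 18 12 7 :=
    S_sub_S_k 0 2 0 1 6 rfl
  have h10 : S 4 6 3 1 - S 4 6 4 1 =
      X ^ 2 * T ^ 9 * S 12 22 15 7 :=
    S_sub_S_k 4 6 3 1 9 rfl
  have h11 : S 4 6 3 2 - S 4 6 4 2 =
      X ^ 2 * T ^ 9 * S 12 22 15 8 :=
    S_sub_S_k 4 6 3 2 9 rfl
  have h12 : S 4 8 4 1 - S 4 8 5 1 =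
      X ^ 2 * T ^ 10 * S 12 24 16 7 :=
    S_sub_S_k 4 8 4 1 10 rfl
  have h13 : S 4 8 4 2 - S 4 8 5 2 =
      X ^ 2 * T ^ 10 * S 12 24 16 8 :=
    S_sub_S_k 4 8 4 2 10 rfl
  have h14 : S 0 2 0 (-1) - S 0 2 0 0 =
      X ^ 1 * T ^ 1 * S 4 10 6 3 :=
    S_sub_S_l 0 2 0 (-1) 1 rfl
  have h15 : S 2 2 1 0 - S 2 2 1 1 =
      X ^ 1 * T ^ 2 * S 6 10 7 4 :=
    S_sub_S_l 2 2 1 0 2 rfl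
  have h16 : S 4 6 3 1 - S 4 6 3 2 =
      X ^ 1 * T ^ 3 * S 8 14 9 5 :=
    S_sub_S_l 4 6 3 1 3 rfl
  have h17 : S 4 6 4 1 - S 4 6 4 2 =
      X ^ 1 * T ^ 3 * S 8 14 10 5 :=
    S_sub_S_l 4 6 4 1 3 rfl
  have h18 : S 4 8 4 1 - S 4 8 4 2 =
      X ^ 1 * T ^ 3 * S 8 16 10 5 :=
    S_sub_S_l 4 8 4 1 3 rfl
  have h19 : S 4 8 5 1 - S 4 8 5 2 =
      X ^ 1 * T ^ 3 * S 8 16 11 5 :=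
    S_sub_S_l 4 8 5 1 3 rfl
  have h20 : S 4 10 6 3 - S 4 10 6 4 =
      X ^ 1 * T ^ 5 * S 8 18 12 7 :=
    S_sub_S_l 4 10 6 3 5 rfl
  have h21 : S 8 16 10 5 - S 8 16 10 6 =
      X ^ 1 * T ^ 7 * S 12 24 16 9 :=
    S_sub_S_l 8 16 10 5 7 rfl
  linear_combination S_eq_add_one + S_sub_S_five_six + h1 + (T ^ 2) * X * h2 + (-1) * h3 + (-1) * h4
    + h5 + h6 + (-1) * h7 + (-1) * h8 + h9 + (T) * X * h10 + (-T) * X * h11 + (T ^ 2) * X * h12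
    + (-T ^ 2) * X * h13 + (-1) * h14 + (-1) * h15 + (-T) * X * h16 + (T) * X * h17
    + (-T ^ 2) * X * h18 + (T ^ 2) * X * h19 + (-T) * X * h20 + (-T ^ 5) * X ^ 2 * h21

/-- This is the row of `F₇` with `F₀(xq²) = F₅(xq²) + x²q⁶ F₄(xq⁴)`; solving it for `F₄(xq⁴)`
produces `seriesFour`. One chain of relations leads from `S 0 0 0 0` to `S 4 4 2 1` and leaves the
extra term `xq² S 8 8 6 4`; a second chain carries that term to `xq² S 6 8 5 2`. -/
theorem S_eq_add_six :
    S 0 0 0 0 =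
      S 4 4 2 1 + X ^ 2 * T ^ 6 * S 10 12 8 4 + X ^ 3 * T ^ 12 * S 16 24 16 9
      + X ^ 3 * T ^ 14 * S 16 26 16 9 + X ^ 2 * T ^ 6 * S 12 20 12 7
      + X ^ 2 * T ^ 7 * S 12 20 13 7 - X ^ 3 * T ^ 12 * S 14 20 13 6
      - X ^ 3 * T ^ 13 * S 16 24 17 8 - X ^ 2 * T ^ 6 * S 12 16 12 6
      - X ^ 2 * T ^ 7 * S 12 16 12 7 + X * T ^ 2 * S 6 8 5 2 + X ^ 2 * T ^ 4 * S 8 12 8 4 := by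
  have h1 : S 0 0 0 0 - S 2 0 0 0 =
      X ^ 2 * T ^ 4 * S 8 12 8 4 :=
    S_sub_S_i 0 0 0 0 4 rfl
  have h2 : S 2 0 0 0 - S 4 0 0 0 =
      X ^ 2 * T ^ 6 * S 10 12 8 4 :=
    S_sub_S_i 2 0 0 0 6 rfl
  have h3 : S 6 8 5 2 - S 8 8 5 2 =
      X ^ 2 * T ^ 10 * S 14 20 13 6 :=
    S_sub_S_i 6 8 5 2 10 rfl
  have h4 : S 4 0 0 1 - S 4 2 0 1 =
      X ^ 3 * T ^ 12 * S 16 24 16 9 :=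
    S_sub_S_j 4 0 0 1 12 rfl
  have h5 : S 4 2 0 1 - S 4 4 0 1 =
      X ^ 3 * T ^ 14 * S 16 26 16 9 :=
    S_sub_S_j 4 2 0 1 14 rfl
  have h6 : S 4 4 0 1 - S 4 4 1 1 =
      X ^ 2 * T ^ 6 * S 12 20 12 7 :=
    S_sub_S_k 4 4 0 1 6 rfl
  have h7 : S 4 4 1 1 - S 4 4 2 1 =
      X ^ 2 * T ^ 7 * S 12 20 13 7 :=
    S_sub_S_k 4 4 1 1 7 rfl
  have h8 : S 8 8 5 2 - S 8 8 6 2 =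
      X ^ 2 * T ^ 11 * S 16 24 17 8 :=
    S_sub_S_k 8 8 5 2 11 rfl
  have h9 : S 4 0 0 0 - S 4 0 0 1 =
      X ^ 1 * T ^ 2 * S 8 8 6 4 :=
    S_sub_S_l 4 0 0 0 2 rfl
  have h10 : S 8 8 6 2 - S 8 8 6 3 =
      X ^ 1 * T ^ 4 * S 12 16 12 6 :=
    S_sub_S_l 8 8 6 2 4 rfl
  have h11 : S 8 8 6 3 - S 8 8 6 4 =
      X ^ 1 * T ^ 5 * S 12 16 12 7 :=
    S_sub_S_l 8 8 6 3 5 rfl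
  linear_combination h1 + h2 + (-T ^ 2) * X * h3 + h4 + h5 + h6 + h7 + (-T ^ 2) * X * h8 + h9
    + (-T ^ 2) * X * h10 + (-T ^ 2) * X * h11

/-- This is the row of `F₄`, shifted once and multiplied by `x²q²`. With that factor, terms such as
`x²q² S 8 14 8 5` are themselves right sides of contiguous relations with smaller parameters, and
those relations can enter the certificate. -/
theorem X_sq_mul_S_eq_add_four :
    X ^ 2 * T ^ 2 * S 6 6 4 2 + X ^ 3 * T ^ 6 * S 12 18 12 7 + X ^ 3 * T ^ 8 * S 12 20 12 7
      + X ^ 2 * T ^ 2 * S 8 14 8 5 + X ^ 2 * T ^ 3 * S 8 14 9 5 - X ^ 3 * T ^ 6 * S 10 14 9 4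
      - X ^ 3 * T ^ 7 * S 12 18 13 6 - X ^ 2 * T ^ 2 * S 8 10 8 4 - X ^ 2 * T ^ 3 * S 8 10 8 5 =
      X ^ 3 * T ^ 6 * S 10 12 8 4 + X ^ 4 * T ^ 12 * S 16 24 16 9
      + X ^ 4 * T ^ 14 * S 16 26 16 9 + X ^ 3 * T ^ 6 * S 12 20 12 7
      + X ^ 3 * T ^ 7 * S 12 20 13 7 - X ^ 4 * T ^ 12 * S 14 20 13 6
      - X ^ 4 * T ^ 13 * S 16 24 17 8 - X ^ 3 * T ^ 6 * S 12 16 12 6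
      - X ^ 3 * T ^ 7 * S 12 16 12 7 + X ^ 2 * T ^ 2 * S 8 12 8 4 := by
  have h1 : S (-2) (-2) (-1) 0 - S 0 (-2) (-1) 0 =
      X ^ 2 * T ^ 2 * S 6 10 7 4 :=
    S_sub_S_i (-2) (-2) (-1) 0 2 rfl
  have h2 : S (-2) (-6) (-4) (-1) - S 0 (-6) (-4) (-1) =
      X ^ 2 * T ^ 2 * S 6 6 4 3 :=
    S_sub_S_i (-2) (-6) (-4) (-1) 2 rfl
  have h3 : S 2 4 3 1 - S 4 4 3 1 =
      X ^ 2 * T ^ 6 * S 10 16 11 5 :=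
    S_sub_S_i 2 4 3 1 6 rfl
  have h4 : S 2 2 2 1 - S 4 2 2 1 =
      X ^ 2 * T ^ 6 * S 10 14 10 5 :=
    S_sub_S_i 2 2 2 1 6 rfl
  have h5 : S 2 2 1 0 - S 4 2 1 0 =
      X ^ 2 * T ^ 6 * S 10 14 9 4 :=
    S_sub_S_i 2 2 1 0 6 rfl
  have h6 : S 2 0 0 0 - S 4 0 0 0 =
      X ^ 2 * T ^ 6 * S 10 12 8 4 :=
    S_sub_S_i 2 0 0 0 6 rfl
  have h7 : S 2 6 5 3 - S 4 6 5 3 =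
      X ^ 2 * T ^ 6 * S 10 18 13 7 :=
    S_sub_S_i 2 6 5 3 6 rfl
  have h8 : S 6 10 8 5 - S 8 10 8 5 =
      X ^ 2 * T ^ 10 * S 14 22 16 9 :=
    S_sub_S_i 6 10 8 5 10 rfl
  have h9 : S 6 8 5 2 - S 8 8 5 2 =
      X ^ 2 * T ^ 10 * S 14 20 13 6 :=
    S_sub_S_i 6 8 5 2 10 rfl
  have h10 : S 6 12 8 5 - S 8 12 8 5 =
      X ^ 2 * T ^ 10 * S 14 24 16 9 :=
    S_sub_S_i 6 12 8 5 10 rfl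
  have h11 : S 6 12 9 5 - S 8 12 9 5 =
      X ^ 2 * T ^ 10 * S 14 24 17 9 :=
    S_sub_S_i 6 12 9 5 10 rfl
  have h12 : S 6 14 10 5 - S 8 14 10 5 =
      X ^ 2 * T ^ 10 * S 14 26 18 9 :=
    S_sub_S_i 6 14 10 5 10 rfl
  have h13 : S (-2) (-4) (-2) (-1) - S (-2) (-2) (-2) (-1) =
      X ^ 3 * T ^ 8 * S 10 20 14 7 :=
    S_sub_S_j (-2) (-4) (-2) (-1) 8 rfl
  have h14 : S (-2) (-6) (-3) (-1) - S (-2) (-4) (-3) (-1) =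
      X ^ 3 * T ^ 6 * S 10 18 13 7 :=
    S_sub_S_j (-2) (-6) (-3) (-1) 6 rfl
  have h15 : S (-2) (-6) (-4) (-1) - S (-2) (-4) (-4) (-1) =
      X ^ 3 * T ^ 6 * S 10 18 12 7 :=
    S_sub_S_j (-2) (-6) (-4) (-1) 6 rfl
  have h16 : S 0 (-4) (-4) (-1) - S 0 (-2) (-4) (-1) =
      X ^ 3 * T ^ 8 * S 12 20 12 7 :=
    S_sub_S_j 0 (-4) (-4) (-1) 8 rfl
  have h17 : S 0 (-6) (-4) (-1) - S 0 (-4) (-4) (-1) =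
      X ^ 3 * T ^ 6 * S 12 18 12 7 :=
    S_sub_S_j 0 (-6) (-4) (-1) 6 rfl
  have h18 : S 2 2 2 1 - S 2 4 2 1 =
      X ^ 3 * T ^ 14 * S 14 26 18 9 :=
    S_sub_S_j 2 2 2 1 14 rfl
  have h19 : S 2 0 1 1 - S 2 2 1 1 =
      X ^ 3 * T ^ 12 * S 14 24 17 9 :=
    S_sub_S_j 2 0 1 1 12 rfl
  have h20 : S 2 0 0 1 - S 2 2 0 1 =
      X ^ 3 * T ^ 12 * S 14 24 16 9 :=
    S_sub_S_j 2 0 0 1 12 rfl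
  have h21 : S 4 2 0 1 - S 4 4 0 1 =
      X ^ 3 * T ^ 14 * S 16 26 16 9 :=
    S_sub_S_j 4 2 0 1 14 rfl
  have h22 : S 4 0 0 1 - S 4 2 0 1 =
      X ^ 3 * T ^ 12 * S 16 24 16 9 :=
    S_sub_S_j 4 0 0 1 12 rfl
  have h23 : S (-2) (-2) (-2) (-1) - S (-2) (-2) (-1) (-1) =
      X ^ 2 * T ^ 4 * S 6 14 10 5 :=
    S_sub_S_k (-2) (-2) (-2) (-1) 4 rfl
  have h24 : S (-2) (-4) (-3) (-1) - S (-2) (-4) (-2) (-1) =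
      X ^ 2 * T ^ 3 * S 6 12 9 5 :=
    S_sub_S_k (-2) (-4) (-3) (-1) 3 rfl
  have h25 : S (-2) (-4) (-4) (-1) - S (-2) (-4) (-3) (-1) =
      X ^ 2 * T ^ 2 * S 6 12 8 5 :=
    S_sub_S_k (-2) (-4) (-4) (-1) 2 rfl
  have h26 : S (-2) (-6) (-4) (-1) - S (-2) (-6) (-3) (-1) =
      X ^ 2 * T ^ 2 * S 6 10 8 5 :=
    S_sub_S_k (-2) (-6) (-4) (-1) 2 rfl
  have h27 : S 0 (-2) (-2) (-1) - S 0 (-2) (-1) (-1) =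
      X ^ 2 * T ^ 4 * S 8 14 10 5 :=
    S_sub_S_k 0 (-2) (-2) (-1) 4 rfl
  have h28 : S 0 (-2) (-3) (-1) - S 0 (-2) (-2) (-1) =
      X ^ 2 * T ^ 3 * S 8 14 9 5 :=
    S_sub_S_k 0 (-2) (-3) (-1) 3 rfl
  have h29 : S 0 (-2) (-4) (-1) - S 0 (-2) (-3) (-1) =
      X ^ 2 * T ^ 2 * S 8 14 8 5 :=
    S_sub_S_k 0 (-2) (-4) (-1) 2 rfl
  have h30 : S 0 (-4) (-4) (-1) - S 0 (-4) (-3) (-1) =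
      X ^ 2 * T ^ 2 * S 8 12 8 5 :=
    S_sub_S_k 0 (-4) (-4) (-1) 2 rfl
  have h31 : S 0 (-4) (-4) (-2) - S 0 (-4) (-3) (-2) =
      X ^ 2 * T ^ 2 * S 8 12 8 4 :=
    S_sub_S_k 0 (-4) (-4) (-2) 2 rfl
  have h32 : S 2 4 2 1 - S 2 4 3 1 =
      X ^ 2 * T ^ 8 * S 10 20 14 7 :=
    S_sub_S_k 2 4 2 1 8 rfl
  have h33 : S 2 2 1 1 - S 2 2 2 1 =
      X ^ 2 * T ^ 7 * S 10 18 13 7 :=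
    S_sub_S_k 2 2 1 1 7 rfl
  have h34 : S 2 2 0 1 - S 2 2 1 1 =
      X ^ 2 * T ^ 6 * S 10 18 12 7 :=
    S_sub_S_k 2 2 0 1 6 rfl
  have h35 : S 2 0 0 1 - S 2 0 1 1 =
      X ^ 2 * T ^ 6 * S 10 16 12 7 :=
    S_sub_S_k 2 0 0 1 6 rfl
  have h36 : S 4 4 1 1 - S 4 4 2 1 =
      X ^ 2 * T ^ 7 * S 12 20 13 7 :=
    S_sub_S_k 4 4 1 1 7 rfl
  have h37 : S 4 4 0 1 - S 4 4 1 1 =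
      X ^ 2 * T ^ 6 * S 12 20 12 7 :=
    S_sub_S_k 4 4 0 1 6 rfl
  have h38 : S 4 2 1 0 - S 4 2 2 0 =
      X ^ 2 * T ^ 7 * S 12 18 13 6 :=
    S_sub_S_k 4 2 1 0 7 rfl
  have h39 : S 6 8 5 3 - S 6 8 6 3 =
      X ^ 2 * T ^ 11 * S 14 24 17 9 :=
    S_sub_S_k 6 8 5 3 11 rfl
  have h40 : S 8 8 5 2 - S 8 8 6 2 =
      X ^ 2 * T ^ 11 * S 16 24 17 8 :=
    S_sub_S_k 8 8 5 2 11 rfl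
  have h41 : S (-2) (-2) (-1) (-1) - S (-2) (-2) (-1) 0 =
      X ^ 1 * T ^ 1 * S 2 6 5 3 :=
    S_sub_S_l (-2) (-2) (-1) (-1) 1 rfl
  have h42 : S 0 (-2) (-1) (-1) - S 0 (-2) (-1) 0 =
      X ^ 1 * T ^ 1 * S 4 6 5 3 :=
    S_sub_S_l 0 (-2) (-1) (-1) 1 rfl
  have h43 : S 0 (-4) (-3) (-2) - S 0 (-4) (-3) (-1) =
      X ^ 1 * T ^ 0 * S 4 4 3 2 :=
    S_sub_S_l 0 (-4) (-3) (-2) 0 rfl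
  have h44 : S 0 (-4) (-4) (-2) - S 0 (-4) (-4) (-1) =
      X ^ 1 * T ^ 0 * S 4 4 2 2 :=
    S_sub_S_l 0 (-4) (-4) (-2) 0 rfl
  have h45 : S 2 2 1 0 - S 2 2 1 1 =
      X ^ 1 * T ^ 2 * S 6 10 7 4 :=
    S_sub_S_l 2 2 1 0 2 rfl
  have h46 : S 2 0 0 0 - S 2 0 0 1 =
      X ^ 1 * T ^ 2 * S 6 8 6 4 :=
    S_sub_S_l 2 0 0 0 2 rfl
  have h47 : S 4 4 3 1 - S 4 4 3 2 =
      X ^ 1 * T ^ 3 * S 8 12 9 5 :=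
    S_sub_S_l 4 4 3 1 3 rfl
  have h48 : S 4 4 2 1 - S 4 4 2 2 =
      X ^ 1 * T ^ 3 * S 8 12 8 5 :=
    S_sub_S_l 4 4 2 1 3 rfl
  have h49 : S 4 2 2 0 - S 4 2 2 1 =
      X ^ 1 * T ^ 2 * S 8 10 8 4 :=
    S_sub_S_l 4 2 2 0 2 rfl
  have h50 : S 4 0 0 0 - S 4 0 0 1 =
      X ^ 1 * T ^ 2 * S 8 8 6 4 :=
    S_sub_S_l 4 0 0 0 2 rfl
  have h51 : S 6 8 6 3 - S 6 8 6 4 =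
      X ^ 1 * T ^ 5 * S 10 16 12 7 :=
    S_sub_S_l 6 8 6 3 5 rfl
  have h52 : S 6 8 5 2 - S 6 8 5 3 =
      X ^ 1 * T ^ 4 * S 10 16 11 6 :=
    S_sub_S_l 6 8 5 2 4 rfl
  have h53 : S 6 6 4 2 - S 6 6 4 3 =
      X ^ 1 * T ^ 4 * S 10 14 10 6 :=
    S_sub_S_l 6 6 4 2 4 rfl
  have h54 : S 8 8 6 3 - S 8 8 6 4 =
      X ^ 1 * T ^ 5 * S 12 16 12 7 :=
    S_sub_S_l 8 8 6 3 5 rfl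
  have h55 : S 8 8 6 2 - S 8 8 6 3 =
      X ^ 1 * T ^ 4 * S 12 16 12 6 :=
    S_sub_S_l 8 8 6 2 4 rfl
  have h56 : S 10 16 11 5 - S 10 16 11 6 =
      X ^ 1 * T ^ 7 * S 14 24 17 9 :=
    S_sub_S_l 10 16 11 5 7 rfl
  have h57 : S 10 14 10 5 - S 10 14 10 6 =
      X ^ 1 * T ^ 7 * S 14 22 16 9 :=
    S_sub_S_l 10 14 10 5 7 rfl
  linear_combination h1 + (-1) * h2 + (-1) * X * h3 + (-1) * X * h4 + X * h5 + X * h6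
    + (T) * X * h7 + (T ^ 3) * X ^ 2 * h8 + (-T ^ 2) * X ^ 2 * h9
    + (T ^ 2 + -T ^ 3) * X ^ 2 * h10 + (T ^ 3) * X ^ 2 * h11 + (T ^ 4) * X ^ 2 * h12 + h13
    + (T) * h14 + (1 + -T) * h15 + (-1) * h16 + (-1) * h17 + (-1) * X * h18 + (-T) * X * h19
    + (-1 + T) * X * h20 + X * h21 + X * h22 + h23 + h24 + (1 + -T) * h25 + (T) * h26
    + (-1) * h27 + (-1) * h28 + (-1) * h29 + (-1) * h30 + h31 + (-1) * X * h32 + (-2) * X * h33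
    + (-1 + T) * X * h34 + (-T) * X * h35 + X * h36 + X * h37 + X * h38 + (T ^ 2) * X ^ 2 * h39
    + (-T ^ 2) * X ^ 2 * h40 + h41 + (-1) * h42 + h43 + (-1) * h44 + (-1) * X * h45
    + (-1) * X * h46 + (-1) * X * h47 + X * h48 + X * h49 + X * h50 + (T ^ 2) * X ^ 2 * h51
    + (T ^ 2) * X ^ 2 * h52 + (T ^ 2) * X ^ 2 * h53 + (-T ^ 2) * X ^ 2 * h54
    + (-T ^ 2) * X ^ 2 * h55 + (-T ^ 6) * X ^ 3 * h56 + (-T ^ 6) * X ^ 3 * h57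

/-! ### The explicit solution and its verification. -/

/-- The solution of the system in terms of quadruple sums: the entry `F₃`. -/
def seriesThree : PowerSeries (LaurentSeries ℤ) :=
  S 0 0 0 1 + X ^ 2 * T ^ 5 * S 8 16 10 6 + X * T * S 4 10 6 4 + X * T ^ 2 * S 4 10 7 4

/-- The solution of the system in terms of quadruple sums: the entry `F₄`. -/
def seriesFour : PowerSeries (LaurentSeries ℤ) :=
  S 2 0 0 0 + X * T ^ 2 * S 8 12 8 5 + X * T ^ 4 * S 8 14 8 5 + S 4 8 4 3 + T * S 4 8 5 3
    - X * T ^ 2 * S 6 8 5 2 - X * T ^ 3 * S 8 12 9 4 - S 4 4 4 2 - T * S 4 4 4 3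

theorem rescale_seriesThree : rescale (qPow 1 ^ 2) seriesThree =
    S 4 6 4 3 + X ^ 2 * T ^ 9 * S 12 22 14 8 + X * T ^ 3 * S 8 16 10 6
      + X * T ^ 4 * S 8 16 11 6 := by
  simp only [seriesThree, map_add, map_mul, map_pow, rescale_qPow_X, rescale_T, rescale_S]
  norm_num
  ring

theorem rescale_seriesFour : rescale (qPow 1 ^ 2) seriesFour =
    S 6 6 4 2 + X * T ^ 4 * S 12 18 12 7 + X * T ^ 6 * S 12 20 12 7 + S 8 14 8 5
      + T * S 8 14 9 5 - X * T ^ 4 * S 10 14 9 4 - X * T ^ 5 * S 12 18 13 6 - S 8 10 8 4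
      - T * S 8 10 8 5 := by
  simp only [seriesFour, map_add, map_sub, map_mul, map_pow, rescale_qPow_X, rescale_T, rescale_S]
  norm_num
  ring

theorem rescale_rescale_seriesFour : rescale (qPow 1 ^ 2) (rescale (qPow 1 ^ 2) seriesFour) =
    S 10 12 8 4 + X * T ^ 6 * S 16 24 16 9 + X * T ^ 8 * S 16 26 16 9 + S 12 20 12 7
      + T * S 12 20 13 7 - X * T ^ 6 * S 14 20 13 6 - X * T ^ 7 * S 16 24 17 8 - S 12 16 12 6
      - T * S 12 16 12 7 := by
  simp only [rescale_seriesFour, map_add, map_sub, map_mul, map_pow, rescale_qPow_X, rescale_T,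
    rescale_S]
  norm_num
  ring

/-- The solution of the system, in terms of quadruple sums. -/
def sumSolution : Fin 7 → PowerSeries (LaurentSeries ℤ) :=
  ![S 0 (-2) (-2) (-1) + X ^ 2 * T ^ 2 * rescale (qPow 1 ^ 2) seriesFour, S 2 2 1 0, S 4 6 4 2,
    seriesThree, seriesFour, S 0 (-2) (-2) (-1), S 0 0 0 0]

theorem constantCoeff_sumSolution (a : Fin 7) : constantCoeff (sumSolution a) = 1 := by
  fin_cases a <;> simp [sumSolution, seriesThree, seriesFour, constantCoeff_S]
  ring

/-- The certificate concerns the shifted equation times `x²q²`; both operations are injective over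
the Laurent series and can be undone. -/
theorem seriesFour_eq : seriesFour = X * T ^ 2 * rescale (qPow 1 ^ 2) seriesFour + S 4 6 4 2 := by
  apply rescale_qPow_injective
  apply mul_left_cancel₀ (mul_ne_zero (pow_ne_zero 2 X_ne_zero) (pow_ne_zero 2 T_ne_zero))
  rw [map_add, map_mul, map_mul, map_pow, rescale_qPow_X, rescale_T, rescale_rescale_seriesFour,
    rescale_seriesFour, rescale_S, show S (4 + 4) (6 + 6) (4 + 4) (2 + 2) = S 8 12 8 4 from rfl]
  linear_combination X_sq_mul_S_eq_add_four

theorem systemEqs_sumSolution : SystemEqs (qPow 1) sumSolution := by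
  have hT : (C (qPow 1) : PowerSeries (LaurentSeries ℤ)) = T := rfl
  constructor <;> rw [← sub_eq_zero]
  all_goals
    simp only [hT, sumSolution, Matrix.cons_val, map_add, map_mul, map_pow, rescale_qPow_X,
      rescale_T, rescale_rescale_seriesFour, rescale_seriesThree, rescale_S]
  all_goals norm_num
  -- Row 0 reduces to row 5, because the entry `F₀` is by definition `F₅ + x²q² F₄(xq²)`. Row 5 in
  -- turn is row 7 plus `F₅ - F₇ = xq F₃(xq²)`.
  · linear_combination S_sub_S_five_six + S_eq_add_six
  · linear_combination S_eq_add_one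
  · rw [seriesThree]
    linear_combination S_eq_add_three
  · linear_combination seriesFour_eq
  · linear_combination S_sub_S_five_six + S_eq_add_six
  · linear_combination S_eq_add_six

end NandiSums

end

theorem mainTheorem1 :
    (∃! F : Fin 7 → NandiSums.XQSeries, NandiSums.IsSystemSolution F) ∧
    ∀ F : Fin 7 → NandiSums.XQSeries, NandiSums.IsSystemSolution F →
      NandiSums.incl (F 1) = NandiSums.S 2 2 1 0 ∧
      NandiSums.incl (F 5) = NandiSums.S 0 (-2) (-2) (-1) ∧
      NandiSums.incl (F 6) = NandiSums.S 0 0 0 0 := by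
  refine ⟨NandiSums.existsUnique_isSystemSolution, fun F hF => ?_⟩
  have h := hF.incl_eq NandiSums.systemEqs_sumSolution NandiSums.constantCoeff_sumSolution
  exact ⟨h 1, h 5, h 6⟩
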